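/- Let $N$ be a free abelian group of finite rank $n$, $M=\operatorname{Hom}(N,\mathbb Z)$, and let a subscript $\mathbb Q$ denote tensoring with $\mathbb Q$. Let $\Sigma$ be a (finite, non-empty) fan of strongly convex rational polyhedral cones in $N_{\mathbb Q}$ and $X=X(\Sigma)$ its toric variety. For $\sigma\in\Sigma$ let $N_\sigma\subseteq N$ be the subgroup generated by $\sigma\cap N$, $\sigma^\perp\subseteq M_{\mathbb Q}$ the space of linear forms vanishing on $\sigma$, and $(M_\sigma)_{\mathbb Q}=M_{\mathbb Q}/\sigma^\perp$, which is dual to $(N_\sigma)_{\mathbb Q}$; write $\langle\cdot,\cdot\rangle$ for the duality pairings. An (equivariant) $\mathbb Q$-Cartier divisor $D$ on $X$ is a family of local equations $m_\sigma\in(M_\sigma)_{\mathbb Q}$, $\sigma\in\Sigma$, such that $m_\tau$ maps to $m_\sigma$ whenever $\sigma$ is a face of $\tau$. Let $Z_*(X)_{\mathbb Q}$ be the $\mathbb Q$-vector space with basis the invariant cycles $[V(\sigma)]$, $\sigma\in\Sigma$, and $[X]=[V(0)]$. Let $0=L_0\subset L_1\subset\dots\subset L_n=M_{\mathbb Q}$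 be a complete flag that is generic with respect to $\Sigma$, i.e. $\sigma^\perp\cap L_j=0$ for every $j$-dimensional $\sigma\in\Sigma$ and every $j$. For $\sigma\in\Sigma$ of dimension $j$ let $\pi_\sigma$ be the projection of $M_{\mathbb Q}$ onto $\sigma^\perp$ along $L_j$, and also the map $(M_\tau)_{\mathbb Q}\to\sigma^\perp/\tau^\perp$ that it induces when $\sigma$ is a face of $\tau$. A $\mathbb Q$-Cartier divisor $D$ with local equations $m_\tau$ acts linearly on $Z_*(X)_{\mathbb Q}$ by $$D\cdot[V(\sigma)]=\sum_{\tau}\langle\pi_\sigma(m_\tau),n_{\tau,\sigma}\rangle\,[V(\tau)],$$ where $\tau$ runs over the cones of $\Sigma$ having $\sigma$ as a facet and $n_{\tau,\sigma}$ is the generator of $N_\tau/N_\sigma$ lying in the image of $\tau$. These operators commute, and for a polynomial $q(x_1,\dots,x_s)$ with rational coefficients $q(E_1,\dots,E_s)$ denotes the cycle obtained by applying to $[X]$ the operator got by substituting for $x_i$ the action of $E_i$. Let $\sigma\in\Sigma$ be a simplicial cone of dimension $k\ge1$, let $E_1,\dots,E_s$ be $\mathbb Q$-Cartier divisors on $X$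 with local equations $m_1,\dots,m_s\in(M_\sigma)_{\mathbb Q}$ on $\sigma$, and let $q_k(x_1,\dots,x_s)$ be a homogeneous polynomial of degree $k$ with rational coefficients. Let $w\in(N_\sigma)_{\mathbb Q}$ be a non-zero vector with $\langle l,w\rangle=0$ for all $l\in L_{k-1}$. Let $t_1,\dots,t_k\in(M_\sigma)_{\mathbb Q}$ lie on the extreme rays of the image in $(M_\sigma)_{\mathbb Q}$ of the dual cone $\sigma^\vee$, and be such that the simplex with vertices $0,t_1,\dots,t_k$ has lattice volume $1/k!$, i.e. $\left|\det(\langle t_j,v_i\rangle)_{i,j}\right|=1$ for a $\mathbb Z$-basis $v_1,\dots,v_k$ of $N_\sigma$. Then $\langle t_i,w\rangle\ne0$ for all $i$, and the coefficient of $[V(\sigma)]$ in $q_k(E_1,\dots,E_s)$ is $$\frac{q_k(\langle m_1,w\rangle,\dots,\langle m_s,w\rangle)}{\langle t_1,w\rangle\cdots\langle t_k,w\rangle}.$$ -/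

import Mathlib

open scoped TensorProduct Nat

noncomputable section

namespace Toric

variable (N : Type*) [AddCommGroup N]

/-- `N_ℚ = ℚ ⊗ N`. -/
abbrev NQ : Type _ := ℚ ⊗[ℤ] N

/-- `M_ℚ = ℚ ⊗ Hom(N, ℤ)`, realised as the dual space of `N_ℚ`. -/
abbrev MQ : Type _ := Module.Dual ℚ (NQ N)

variable {N}

/-- The natural map `N → N_ℚ`. -/
def toNQ : N →ₗ[ℤ] NQ N := TensorProduct.mk ℤ ℚ N 1

/-- The linear span of a cone; for a rational polyhedral cone `σ` it is `ℚ ⊗ N_σ`. -/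
abbrev linSpan (σ : PointedCone ℚ (NQ N)) : Submodule ℚ (NQ N) :=
  Submodule.span ℚ (σ : Set (NQ N))

/-- The dimension of a cone is the dimension of its linear span. -/
def dim {V : Type*} [AddCommGroup V] [Module ℚ V] (σ : PointedCone ℚ V) : ℕ :=
  Module.finrank ℚ (Submodule.span ℚ (σ : Set V))

/-- `N_σ`: the subgroup of `N` generated by `σ ∩ N`. -/
def latticeSpan (σ : PointedCone ℚ (NQ N)) : Submodule ℤ N :=
  Submodule.span ℤ {x : N | toNQ x ∈ σ}

/-- `M(σ) = σ^⊥` (tensored with `ℚ`): the linear forms vanishing on `σ`. -/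
def perp (σ : PointedCone ℚ (NQ N)) : Submodule ℚ (MQ N) :=
  (linSpan σ).dualAnnihilator

/-- `M_σ = M / M(σ)` (tensored with `ℚ`). -/
abbrev MLoc (σ : PointedCone ℚ (NQ N)) : Type _ := MQ N ⧸ perp σ

theorem perp_anti {σ τ : PointedCone ℚ (NQ N)} (h : σ ≤ τ) : perp τ ≤ perp σ :=
  Submodule.dualAnnihilator_anti (Submodule.span_mono h)

theorem toNQ_mem_linSpan (σ : PointedCone ℚ (NQ N)) (x : latticeSpan σ) :
    toNQ (x : N) ∈ linSpan σ := by
  have h : latticeSpan σ ≤ ((linSpan σ).restrictScalars ℤ).comap (toNQ (N := N)) :=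
    Submodule.span_le.2 fun y hy => Submodule.subset_span hy
  exact h x.2

/-- The inclusion of `N_σ` into `ℚ ⊗ N_σ`, the linear span of `σ`. -/
def latticeIncl (σ : PointedCone ℚ (NQ N)) (x : latticeSpan σ) : linSpan σ :=
  ⟨toNQ (x : N), toNQ_mem_linSpan σ x⟩

/-- The duality pairing `⟨·,·⟩` between `M_σ` and `N_σ` (both tensored with `ℚ`): the class of a
linear form `m` on `N_ℚ` is evaluated as the restriction of `m` to the span of `σ`. -/
def pairing (σ : PointedCone ℚ (NQ N)) : MLoc σ →ₗ[ℚ] Module.Dual ℚ (linSpan σ) :=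
  (Subspace.quotAnnihilatorEquiv (linSpan σ)).toLinearMap

/-- `τ → σ`: the cone `σ` is a facet of `τ`. -/
def IsFacet (σ τ : PointedCone ℚ (NQ N)) : Prop :=
  σ.IsFaceOf τ ∧ dim τ = dim σ + 1

/-- `v ∈ N_τ` represents `n_{τ,σ}`: the class of `v` generates `N(σ)_τ = N_τ / N_σ` and lies in the
image of the cone `τ` in `N(σ)_ℚ`. This determines the class of `v` modulo `N_σ`. -/
def IsNormal (σ τ : PointedCone ℚ (NQ N)) (v : latticeSpan τ) : Prop :=
  latticeSpan σ ⊔ Submodule.span ℤ {(v : N)} = latticeSpan τ ∧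
    ∃ y ∈ τ, toNQ (v : N) - y ∈ linSpan σ

open Classical in
/-- A representative in `N_τ` of the lattice generator `n_{τ,σ}` of the image of `τ` in `N(σ)`.
(When `σ` is a facet of a strongly convex rational cone `τ` such a vector exists.) -/
def normalVector (σ τ : PointedCone ℚ (NQ N)) : latticeSpan τ :=
  if h : ∃ v : latticeSpan τ, IsNormal σ τ v then h.choose else 0

/-- The projection `π_σ : M_τ → M(σ)_τ ⊆ M_τ` induced by the projection of `M` onto `M(σ)` along a
complement `P` of `M(σ)`. -/
def projLoc {σ τ : PointedCone ℚ (NQ N)} (h : σ ≤ τ) (P : Submodule ℚ (MQ N))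
    (hP : IsCompl (perp σ) P) : MLoc τ →ₗ[ℚ] MLoc τ :=
  (perp τ).mapQ (perp τ) ((perp σ).projection P hP) fun m hm => by
    have hm' : (perp σ).projection P hP m = m :=
      Submodule.projection_apply_left hP ⟨m, perp_anti h hm⟩
    rw [Submodule.mem_comap, hm']
    exact hm

variable (N) in
/-- A fan: a finite non-empty collection of strongly convex rational polyhedral cones in `N_ℚ`,
closed under passing to faces, such that any two of its cones meet in a common face. (A finitely
generated cone in the rational vector space `N_ℚ` is automatically rational.) -/
structure Fan where
  cones : Finset (PointedCone ℚ (NQ N))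
  nonempty : cones.Nonempty
  fg : ∀ σ ∈ cones, Submodule.FG σ
  salient : ∀ σ ∈ cones, (σ : ConvexCone ℚ (NQ N)).Salient
  face_mem : ∀ σ ∈ cones, ∀ τ : PointedCone ℚ (NQ N), τ.IsFaceOf σ → τ ∈ cones
  inf_mem : ∀ σ ∈ cones, ∀ τ ∈ cones, σ ⊓ τ ∈ cones
  inf_face_left : ∀ σ ∈ cones, ∀ τ ∈ cones, (σ ⊓ τ).IsFaceOf σ
  inf_face_right : ∀ σ ∈ cones, ∀ τ ∈ cones, (σ ⊓ τ).IsFaceOf τ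

namespace Fan

variable (F : Fan N)

/-- The type of cones of the fan. -/
abbrev Cone : Type _ := {σ : PointedCone ℚ (NQ N) // σ ∈ F.cones}

theorem bot_mem : (⊥ : PointedCone ℚ (NQ N)) ∈ F.cones := by
  obtain ⟨σ, hσ⟩ := F.nonempty
  refine F.face_mem σ hσ ⊥ ⟨bot_le, ?_⟩
  intro x y a hx hy ha h
  rw [Submodule.mem_bot] at h ⊢
  by_contra hx0
  refine F.salient σ hσ x hx hx0 ?_
  have e : -x = (⟨a⁻¹, (inv_pos.2 ha).le⟩ : {c : ℚ // 0 ≤ c}) • y := by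
    rw [eq_neg_of_add_eq_zero_right h]
    change -x = a⁻¹ • -(a • x)
    rw [smul_neg, smul_smul, inv_mul_cancel₀ ha.ne', one_smul]
  rw [e]
  exact Submodule.smul_mem σ _ hy

/-- The zero cone, as a cone of the fan. -/
def zeroCone : F.Cone := ⟨⊥, F.bot_mem⟩

/-- `Z_*(X)_ℚ`: the invariant cycles on `X = X(Σ)` with rational coefficients. The basis element
`single σ 1` is `[V(σ)]`; the value at `σ` is the coefficient of `[V(σ)]`. -/
abbrev Cycles : Type _ := F.Cone →₀ ℚ

/-- The cycle `[V(σ)]`. -/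
def orbitCycle (σ : F.Cone) : F.Cycles := Finsupp.single σ 1

/-- The fundamental cycle `[X] = [V(0)]`. -/
def fundamentalCycle : F.Cycles := F.orbitCycle F.zeroCone

/-- An equivariant `ℚ`-Cartier divisor on `X(Σ)`: a collection of local equations
`m_σ ∈ ℚ ⊗ M_σ` such that `m_τ` maps to `m_σ` whenever `σ` is a face of `τ`. -/
structure QCartier where
  eqn : ∀ σ : F.Cone, MLoc σ.1
  compat : ∀ (σ τ : F.Cone) (h : σ.1.IsFaceOf τ.1),
    Submodule.factor (perp_anti h.le) (eqn τ) = eqn σ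

/-- A choice of complements for the fan. -/
structure Complements where
  space : F.Cone → Submodule ℚ (MQ N)
  isCompl : ∀ σ : F.Cone, IsCompl (perp σ.1) (space σ)
  mono : ∀ σ τ : F.Cone, σ.1.IsFaceOf τ.1 → space σ ≤ space τ

variable {F}

/-- `⟨π_σ(m_τ), n_{τ,σ}⟩`: the coefficient of `[V(τ)]` in `D · [V(σ)]`, when `τ → σ`. -/
def actCoeff (Ψ : F.Complements) (D : F.QCartier) (σ τ : F.Cone) (h : σ.1 ≤ τ.1) : ℚ :=
  pairing τ.1 (projLoc h (Ψ.space σ) (Ψ.isCompl σ) (D.eqn τ))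
    (latticeIncl τ.1 (normalVector σ.1 τ.1))

open Classical in
/-- The action of a `ℚ`-Cartier divisor on invariant cycles: the linear map with
`D · [V(σ)] = ∑_{τ → σ} ⟨π_σ(m_τ), n_{τ,σ}⟩ [V(τ)]`. -/
def act (Ψ : F.Complements) (D : F.QCartier) : F.Cycles →ₗ[ℚ] F.Cycles :=
  Finsupp.linearCombination ℚ fun σ : F.Cone =>
    ∑ τ : F.Cone, if h : IsFacet σ.1 τ.1 then actCoeff Ψ D σ τ h.1.le • F.orbitCycle τ else 0

/-- The operator on cycles obtained from a polynomial expression `p` in (not necessarily commuting)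
letters `x_1, …, x_s` by letting `x_i` act as `E_i`, products being compositions. -/
def actExpr (Ψ : F.Complements) {s : ℕ} (E : Fin s → F.QCartier) :
    FreeAlgebra ℚ (Fin s) →ₐ[ℚ] Module.End ℚ F.Cycles :=
  FreeAlgebra.lift ℚ fun i => act Ψ (E i)

end Fan

/-- The polynomial in commuting variables that is written by the expression `p`, that is, `p` with
the order of the factors in its monomials forgotten. A polynomial `q` is written by many
expressions, which differ in the order of the factors. -/
def commPoly {s : ℕ} : FreeAlgebra ℚ (Fin s) →ₐ[ℚ] MvPolynomial (Fin s) ℚ :=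
  FreeAlgebra.lift ℚ fun i => MvPolynomial.X i

/-- A complete flag `0 = L_0 < L_1 < ⋯ < L_n = V` (with `n = dim V`); the subspaces `L_i` for
`i > n` equal `V` and play no role. -/
structure CompleteFlag (V : Type*) [AddCommGroup V] [Module ℚ V] where
  space : ℕ → Submodule ℚ V
  mono : Monotone space
  finrank_space : ∀ i ≤ Module.finrank ℚ V, Module.finrank ℚ (space i) = i

/-- The flag is generic with respect to the fan: `σ^⊥ ∩ L_k = 0` for every `k`-dimensional cone
`σ` of the fan. -/
def CompleteFlag.IsGeneric (L : CompleteFlag (MQ N)) (F : Fan N) : Prop :=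
  ∀ σ ∈ F.cones, perp σ ⊓ L.space (dim σ) = ⊥

/-- The choice of complements given by a generic flag: `Ψ(σ) = L_k` for `k`-dimensional `σ`. -/
def CompleteFlag.complements [Module.Finite ℤ N] (L : CompleteFlag (MQ N)) {F : Fan N} (hL : L.IsGeneric F) :
    F.Complements where
  space σ := L.space (dim σ.1)
  isCompl σ := by
    have hk : dim σ.1 ≤ Module.finrank ℚ (MQ N) := by
      rw [Subspace.dual_finrank_eq]
      exact Submodule.finrank_le _
    have h1 := Subspace.finrank_add_finrank_dualAnnihilator_eq (linSpan σ.1)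
    refine (Submodule.isCompl_iff_disjoint _ _ ?_).2 (disjoint_iff.2 (hL σ.1 σ.2))
    rw [L.finrank_space _ hk, Subspace.dual_finrank_eq, ← h1, dim, perp, add_comm]
  mono σ τ h := L.mono (Submodule.finrank_mono (Submodule.span_mono h.le))

/-- The image in `M_σ` of the dual cone `σ^∨`. -/
def dualImage (σ : PointedCone ℚ (NQ N)) : PointedCone ℚ (MLoc σ) :=
  (PointedCone.dual (Module.Dual.eval ℚ (NQ N)) (σ : Set (NQ N))).map (perp σ).mkQ

/-- `t` lies on an extreme ray (a one-dimensional face) of the cone `C`. -/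
def OnExtremeRay {V : Type*} [AddCommGroup V] [Module ℚ V] (C : PointedCone ℚ V) (t : V) : Prop :=
  ∃ ρ : PointedCone ℚ V, ρ.IsFaceOf C ∧ dim ρ = 1 ∧ t ∈ ρ

open Classical in
/-- The lattice volume of the simplex in `M_σ` with vertices `u 0, …, u k`, where `k` is the rank of
`N_σ`: it is `|det A| / k!`, with `A i j = ⟨u j - u 0, v i⟩` for a `ℤ`-basis `v` of `N_σ`
(the value does not depend on the basis). -/
def simplexVolume (σ : PointedCone ℚ (NQ N)) {k : ℕ} (u : Fin (k + 1) → MLoc σ) : ℚ :=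
  if h : Nonempty (Module.Basis (Fin k) ℤ (latticeSpan σ)) then
    1 / (k ! : ℚ) * |Matrix.det (Matrix.of fun i j : Fin k =>
      pairing σ (u j.succ - u 0) (latticeIncl σ (h.some i)))|
  else 0

end Toric

end

open scoped TensorProduct Nat

noncomputable section

/-! Let `lam i` be the forms dual to generators `u i` of the rays of σ, and let δ(σ) be the absolute
determinant of the `lam j` in a ℤ-basis of N_σ. By linearity it suffices to apply words in the
divisors to [X]. For a word D of length k, `Fan.prod_act_apply` finds the coefficient ∏ D_j(w) ·
δ(σ) / ∏ lam_i(w) at σ; words of any other length contribute zero. The value is symmetric in the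
letters, so the order of the factors never matters.

The proof for words is by induction on dim σ. The leftmost divisor E acts last, so the coefficient
at σ is a sum over the facets τ_i of σ. Since the complement belonging to τ_i kills w, the i-th
action coefficient is E(w) · lam_i(n_i) / lam_i(w), where n_i is the normal vector
(`Fan.mul_actCoeff`), and δ(σ) = lam_i(n_i) · δ(τ_i) (`abs_det_latticeMatrix_facet`). For dim σ = k
+ 1 ≥ 2, the annihilator of L_{k-1} in the span of σ contains a vector v independent of w. The line
v + ℚw meets the hyperplane lam_i = 0 in a vector z_i, which serves as the vector w for τ_i. What
remains is an identity among values at the z_i: Lagrange's formula for the leading coefficient of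
the polynomial x ↦ ∏ D_j(v + xw), with the parameters of the z_i as nodes (`sum_prod_div_eq`).

Finally, the extreme rays of the dual cone are spanned by the `lam j`, so the t_i are multiples of
the `lam j`. The volume condition makes this a bijection and gives δ(σ) · ∏ t_i(w) = ∏ lam_i(w)
(`prod_pairing_eq`). -/

namespace Toric

/-! ### Simplicial cones, their dual forms and their facets. -/

section SimplicialCone

variable {V : Type*} [AddCommGroup V] [Module ℚ V] {k : ℕ}

/-- The linear forms `lam i` are dual to the vectors `u i`. -/
def IsDualFamily (u : Fin k → V) (lam : Fin k → Module.Dual ℚ V) : Prop :=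
  ∀ i j, lam i (u j) = if i = j then 1 else 0

/-- The cone generated by a finite family of vectors. -/
def coneOf (u : Fin k → V) : PointedCone ℚ V := PointedCone.hull ℚ (Set.range u)

theorem mem_coneOf (u : Fin k → V) (i : Fin k) : u i ∈ coneOf u :=
  Submodule.subset_span ⟨i, rfl⟩

theorem span_coneOf (u : Fin k → V) :
    Submodule.span ℚ (coneOf u : Set V) = Submodule.span ℚ (Set.range u) :=
  le_antisymm (Submodule.span_le.2 (PointedCone.hull_le_span ℚ _))
    (Submodule.span_mono Submodule.subset_span)

theorem smul_mem_cone (C : PointedCone ℚ V) {x : V} {c : ℚ} (hc : 0 ≤ c) (hx : x ∈ C) :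
    c • x ∈ C :=
  C.smul_mem hc hx

theorem exists_coeff_of_mem_coneOf {u : Fin k → V} {x : V} (hx : x ∈ coneOf u) :
    ∃ c : Fin k → ℚ, (∀ i, 0 ≤ c i) ∧ ∑ i, c i • u i = x := by
  obtain ⟨c, hc⟩ := (Submodule.mem_span_range_iff_exists_fun _).1 hx
  exact ⟨fun i => (c i : ℚ), fun i => (c i).2, hc⟩

theorem exists_dualFamily {u : Fin k → V} (hu : LinearIndependent ℚ u) :
    ∃ lam, IsDualFamily u lam := by
  have h (i : Fin k) := LinearMap.exists_extend ((Module.Basis.span hu).coord i)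
  choose lam hlam using h
  refine ⟨lam, fun i j => ?_⟩
  have h1 : u j = (Submodule.span ℚ (Set.range u)).subtype (Module.Basis.span hu j) := by
    simp [Module.Basis.span_apply]
  rw [h1, ← LinearMap.comp_apply, hlam, Module.Basis.coord_apply, Module.Basis.repr_self,
    Finsupp.single_apply]
  simp [eq_comm]

namespace IsDualFamily

variable {u : Fin k → V} {lam : Fin k → Module.Dual ℚ V}

theorem apply_sum (hd : IsDualFamily u lam) (c : Fin k → ℚ) (i : Fin k) :
    lam i (∑ j, c j • u j) = c i := by
  simp [hd i]

theorem linearIndependent (hd : IsDualFamily u lam) : LinearIndependent ℚ u := by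
  rw [Fintype.linearIndependent_iff]
  intro g hg i
  rw [← hd.apply_sum g i, hg, map_zero]

theorem sum_eq (hd : IsDualFamily u lam) {x : V}
    (hx : x ∈ Submodule.span ℚ (coneOf u : Set V)) : ∑ i, lam i x • u i = x := by
  rw [span_coneOf] at hx
  obtain ⟨c, rfl⟩ := (Submodule.mem_span_range_iff_exists_fun _).1 hx
  simp only [hd.apply_sum]

theorem mem_coneOf_iff (hd : IsDualFamily u lam) {x : V} :
    x ∈ coneOf u ↔ x ∈ Submodule.span ℚ (coneOf u : Set V) ∧ ∀ i, 0 ≤ lam i x := by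
  constructor
  · intro hx
    refine ⟨Submodule.subset_span hx, fun i => ?_⟩
    obtain ⟨c, hc, rfl⟩ := exists_coeff_of_mem_coneOf hx
    rw [hd.apply_sum]
    exact hc i
  · rintro ⟨hx, h⟩
    rw [← hd.sum_eq hx]
    exact Submodule.sum_mem _ fun i _ => smul_mem_cone _ (h i) (mem_coneOf u i)

theorem dim_coneOf (hd : IsDualFamily u lam) : dim (coneOf u) = k := by
  rw [dim, span_coneOf, finrank_span_eq_card hd.linearIndependent, Fintype.card_fin]

end IsDualFamily

/-- The facet of `coneOf u` opposite to the generator `u i`. -/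
def facet (u : Fin (k + 1) → V) (i : Fin (k + 1)) : PointedCone ℚ V :=
  coneOf (u ∘ i.succAbove)

namespace IsDualFamily

variable {u : Fin (k + 1) → V} {lam : Fin (k + 1) → Module.Dual ℚ V}

theorem comp_succAbove (hd : IsDualFamily u lam) (i : Fin (k + 1)) :
    IsDualFamily (u ∘ i.succAbove) (lam ∘ i.succAbove) := fun a b => by
  simp [hd _ _]

theorem apply_eq_zero_of_mem_span_facet (hd : IsDualFamily u lam) {i : Fin (k + 1)} {x : V}
    (hx : x ∈ Submodule.span ℚ (facet u i : Set V)) : lam i x = 0 := by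
  rw [facet, span_coneOf] at hx
  obtain ⟨c, rfl⟩ := (Submodule.mem_span_range_iff_exists_fun _).1 hx
  simp [hd i, (Fin.succAbove_ne _ _).symm]

theorem mem_span_facet (hd : IsDualFamily u lam) {i : Fin (k + 1)} {x : V}
    (hx : x ∈ Submodule.span ℚ (coneOf u : Set V)) (h : lam i x = 0) :
    x ∈ Submodule.span ℚ (facet u i : Set V) := by
  rw [← hd.sum_eq hx, Fin.sum_univ_succAbove _ i, h, zero_smul, zero_add]
  exact Submodule.sum_mem _ fun j _ => Submodule.smul_mem _ _
    (Submodule.subset_span (mem_coneOf (u ∘ i.succAbove) j))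

theorem mem_facet (hd : IsDualFamily u lam) {i : Fin (k + 1)} {x : V}
    (hx : x ∈ coneOf u) (h : lam i x = 0) : x ∈ facet u i :=
  (hd.comp_succAbove i).mem_coneOf_iff.2
    ⟨hd.mem_span_facet (Submodule.subset_span hx) h, fun _ => (hd.mem_coneOf_iff.1 hx).2 _⟩

theorem facet_le (u : Fin (k + 1) → V) (i : Fin (k + 1)) : facet u i ≤ coneOf u :=
  Submodule.span_mono (Set.range_comp_subset_range _ _)

theorem facet_isFaceOf (hd : IsDualFamily u lam) (i : Fin (k + 1)) :
    (facet u i).IsFaceOf (coneOf u) := by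
  refine ⟨facet_le u i, fun {x y a} hx hy ha h => hd.mem_facet hx ?_⟩
  have h0 := hd.apply_eq_zero_of_mem_span_facet (Submodule.subset_span h)
  rw [map_add, map_smul, smul_eq_mul] at h0
  have h1 := (hd.mem_coneOf_iff.1 hx).2 i
  have h2 := (hd.mem_coneOf_iff.1 hy).2 i
  have h3 : a * lam i x = 0 := by nlinarith [mul_nonneg ha.le h1]
  exact (mul_eq_zero.1 h3).resolve_left ha.ne'

theorem dim_facet (hd : IsDualFamily u lam) (i : Fin (k + 1)) : dim (facet u i) = k :=
  (hd.comp_succAbove i).dim_coneOf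

theorem facet_injective (hd : IsDualFamily u lam) : Function.Injective (facet u) := by
  intro i j h
  by_contra hij
  obtain ⟨l, hl⟩ := Fin.exists_succAbove_eq hij
  have h1 : u i ∈ facet u j := hl ▸ mem_coneOf (u ∘ j.succAbove) l
  rw [← h] at h1
  have := hd.apply_eq_zero_of_mem_span_facet (Submodule.subset_span h1)
  simp [hd i i] at this

/-- A point of the face with positive i-th coordinate would force `u i` into the face. -/
theorem le_facet_of_notMem (hd : IsDualFamily u lam) {τ : PointedCone ℚ V}
    (hτ : τ.IsFaceOf (coneOf u)) {i : Fin (k + 1)} (hi : u i ∉ τ) : τ ≤ facet u i := by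
  intro x hx
  have hx' := hτ.le hx
  refine hd.mem_facet hx' (le_antisymm (not_lt.1 fun hpos => hi ?_)
    ((hd.mem_coneOf_iff.1 hx').2 i))
  rw [← hd.sum_eq (Submodule.subset_span hx')] at hx
  exact hτ.mem_of_sum_smul_mem (fun j => mem_coneOf u j) (hd.mem_coneOf_iff.1 hx').2 hx i hpos

/-- A proper face misses some `u i`, hence lies in the opposite facet, and equality of dimensions
makes the spans agree. If it missed a second generator, the form dual to that generator would vanish
on this common span, which contains the generator. -/
theorem eq_facet (hd : IsDualFamily u lam) {τ : PointedCone ℚ V}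
    (hτ : τ.IsFaceOf (coneOf u)) (hdim : dim τ = k) : ∃ i, τ = facet u i := by
  have fin (i : Fin (k + 1)) : FiniteDimensional ℚ (Submodule.span ℚ (facet u i : Set V)) := by
    rw [facet, span_coneOf]
    exact FiniteDimensional.span_of_finite ℚ (Set.finite_range _)
  have : ∃ i, u i ∉ τ := by
    by_contra! h
    have h1 : τ = coneOf u := le_antisymm hτ.le (Submodule.span_le.2 (by rintro _ ⟨i, rfl⟩; exact h i))
    rw [h1, hd.dim_coneOf] at hdim
    omega
  obtain ⟨i, hi⟩ := this
  have hle := hd.le_facet_of_notMem hτ hi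
  refine ⟨i, le_antisymm hle (Submodule.span_le.2 ?_)⟩
  rintro _ ⟨j, rfl⟩
  by_contra hj
  have hle' := hd.le_facet_of_notMem hτ hj
  have hspan : Submodule.span ℚ (τ : Set V) = Submodule.span ℚ (facet u i : Set V) := by
    have := fin i
    refine Submodule.eq_of_le_of_finrank_eq (Submodule.span_mono hle) ?_
    exact hdim.trans (hd.dim_facet i).symm
  have h1 : u (i.succAbove j) ∈ Submodule.span ℚ (τ : Set V) := by
    rw [hspan]
    exact Submodule.subset_span (mem_coneOf (u ∘ i.succAbove) j)
  have h2 := hd.apply_eq_zero_of_mem_span_facet (Submodule.span_mono hle' h1)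
  simp [hd _ _] at h2

end IsDualFamily

end SimplicialCone

/-! ### The lattices N_σ, normal vectors and determinants. -/

section Lattice

variable {N : Type*} [AddCommGroup N]

theorem isFacet_coneOf_iff {k : ℕ} {u : Fin (k + 1) → NQ N} {lam : Fin (k + 1) → MQ N}
    (hd : IsDualFamily u lam) {τ : PointedCone ℚ (NQ N)} :
    IsFacet τ (coneOf u) ↔ ∃ i, τ = facet u i := by
  constructor
  · rintro ⟨h1, h2⟩
    rw [hd.dim_coneOf] at h2
    exact hd.eq_facet h1 (by omega)
  · rintro ⟨i, rfl⟩
    exact ⟨hd.facet_isFaceOf i, by rw [hd.dim_coneOf, hd.dim_facet]⟩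

theorem exists_smul_eq_toNQ (y : NQ N) : ∃ (d : ℕ) (x : N), 0 < d ∧ (d : ℚ) • y = toNQ x := by
  induction y using TensorProduct.induction_on with
  | zero => exact ⟨1, 0, one_pos, by simp⟩
  | tmul q n =>
    refine ⟨q.den, q.num • n, q.den_pos, ?_⟩
    change (q.den : ℚ) • (q ⊗ₜ[ℤ] n) = (1 : ℚ) ⊗ₜ[ℤ] (q.num • n)
    rw [TensorProduct.smul_tmul', smul_eq_mul, Rat.den_mul_eq_num, ← TensorProduct.smul_tmul,
      zsmul_eq_mul, mul_one]
  | add y z hy hz =>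
    obtain ⟨d, x, hd, hx⟩ := hy
    obtain ⟨e, x', he, hx'⟩ := hz
    refine ⟨d * e, (e : ℤ) • x + (d : ℤ) • x', by positivity, ?_⟩
    rw [map_add, map_zsmul, map_zsmul, ← hx, ← hx', smul_add, Nat.cast_mul]
    congr 1
    · rw [← Int.cast_smul_eq_zsmul ℚ, smul_smul, mul_comm]; rfl
    · rw [← Int.cast_smul_eq_zsmul ℚ, smul_smul]; rfl

/-- N_σ is saturated: adding a large multiple of a lattice point in the interior of the cone moves
any lattice point of the span into the cone. -/
theorem mem_latticeSpan_coneOf {k : ℕ} {u : Fin k → NQ N} {lam : Fin k → MQ N}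
    (hd : IsDualFamily u lam) {x : N} :
    x ∈ latticeSpan (coneOf u) ↔ toNQ x ∈ linSpan (coneOf u) := by
  refine ⟨fun hx => toNQ_mem_linSpan _ ⟨x, hx⟩, fun hx => ?_⟩
  choose d z hdpos hz using fun i => exists_smul_eq_toNQ (u i)
  obtain ⟨K, hK⟩ : ∃ K : ℕ, ∀ i, -(lam i (toNQ x)) ≤ K := by
    obtain ⟨K, hK⟩ := exists_nat_ge (∑ i, |lam i (toNQ x)|)
    refine ⟨K, fun i => (neg_le_abs _).trans (le_trans ?_ hK)⟩
    exact Finset.single_le_sum (f := fun i => |lam i (toNQ x)|) (fun _ _ => abs_nonneg _)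
      (Finset.mem_univ i)
  have hz' (i) : toNQ (z i) ∈ coneOf u := by
    rw [← hz]
    exact smul_mem_cone _ (Nat.cast_nonneg _) (mem_coneOf u i)
  have hy : toNQ ((K : ℤ) • ∑ i, z i) = ∑ i, ((K : ℚ) * d i) • u i := by
    rw [map_zsmul, map_sum, ← Int.cast_smul_eq_zsmul ℚ, Finset.smul_sum]
    refine Finset.sum_congr rfl fun i _ => ?_
    rw [← hz, smul_smul]; rfl
  have h1 : (K : ℤ) • ∑ i, z i ∈ latticeSpan (coneOf u) :=
    Submodule.smul_mem _ _ (Submodule.sum_mem _ fun i _ => Submodule.subset_span (hz' i))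
  have h2 : x + (K : ℤ) • ∑ i, z i ∈ latticeSpan (coneOf u) := by
    refine Submodule.subset_span ?_
    rw [Set.mem_ofPred_eq, map_add, hy, ← hd.sum_eq hx, ← Finset.sum_add_distrib]
    refine Submodule.sum_mem _ fun i _ => ?_
    rw [← add_smul]
    refine smul_mem_cone _ ?_ (mem_coneOf u i)
    have : (1 : ℚ) ≤ d i := by exact_mod_cast hdpos i
    nlinarith [hK i, (Nat.cast_nonneg K : (0 : ℚ) ≤ K)]
  simpa using Submodule.sub_mem _ h2 h1

variable {k : ℕ} {u : Fin (k + 1) → NQ N} {lam : Fin (k + 1) → MQ N}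

theorem mem_latticeSpan_facet (hd : IsDualFamily u lam) (i : Fin (k + 1)) {x : N}
    (hx : x ∈ latticeSpan (coneOf u)) (h : lam i (toNQ x) = 0) :
    x ∈ latticeSpan (facet u i) :=
  (mem_latticeSpan_coneOf (hd.comp_succAbove i)).2
    (hd.mem_span_facet ((mem_latticeSpan_coneOf hd).1 hx) h)

theorem apply_latticeSpan_facet (hd : IsDualFamily u lam) (i : Fin (k + 1)) {x : N}
    (hx : x ∈ latticeSpan (facet u i)) : lam i (toNQ x) = 0 :=
  hd.apply_eq_zero_of_mem_span_facet (toNQ_mem_linSpan _ ⟨x, hx⟩)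

theorem latticeSpan_facet_le (u : Fin (k + 1) → NQ N) (i : Fin (k + 1)) :
    latticeSpan (facet u i) ≤ latticeSpan (coneOf u) :=
  Submodule.span_mono fun _ hx => IsDualFamily.facet_le u i hx

theorem exists_lattice_apply_ne_zero (hd : IsDualFamily u lam) (i : Fin (k + 1)) :
    ∃ x ∈ latticeSpan (coneOf u), 0 < lam i (toNQ x) := by
  obtain ⟨d, z, hdpos, hz⟩ := exists_smul_eq_toNQ (u i)
  refine ⟨z, Submodule.subset_span ?_, ?_⟩
  · rw [Set.mem_ofPred_eq, ← hz]
    exact smul_mem_cone _ (Nat.cast_nonneg _) (mem_coneOf u i)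
  · rw [← hz, map_smul, hd i i]
    simpa using hdpos

/-- The form `lam i` maps N_σ onto a finitely generated, hence cyclic, subgroup of ℚ whose kernel in
N_σ is the lattice of the facet. A preimage of the positive generator is a normal vector. -/
theorem exists_isNormal [Module.Finite ℤ N] (hd : IsDualFamily u lam) (i : Fin (k + 1)) :
    ∃ v : latticeSpan (coneOf u), IsNormal (facet u i) (coneOf u) v := by
  let f : N →ₗ[ℤ] ℚ := ((lam i).restrictScalars ℤ).comp toNQ
  have hf (x : N) : f x = lam i (toNQ x) := rfl
  let I : Submodule ℤ ℚ := (latticeSpan (coneOf u)).map f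
  have hI : I.FG := (IsNoetherian.noetherian (latticeSpan (coneOf u))).map f
  have hP : I.IsPrincipal := by
    have := FractionalIdeal.isPrincipal (K := ℚ) (R := ℤ)
      ⟨I, FractionalIdeal.isFractional_of_fg hI⟩
    exact this
  obtain ⟨g, hg⟩ := hP.principal
  obtain ⟨x₀, hx₀, hpos⟩ := exists_lattice_apply_ne_zero hd i
  have hg0 : g ≠ 0 := by
    rintro rfl
    have : f x₀ ∈ I := Submodule.mem_map_of_mem hx₀
    rw [hg, Submodule.span_zero_singleton, Submodule.mem_bot] at this
    exact hpos.ne' this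
  obtain ⟨g, hg, hgpos⟩ : ∃ g : ℚ, I = Submodule.span ℤ {g} ∧ 0 < g := by
    rcases lt_or_gt_of_ne hg0 with h | h
    · exact ⟨-g, by rw [hg, ← Set.neg_singleton, Submodule.span_neg], by simpa using h⟩
    · exact ⟨g, hg, h⟩
  have hgI : g ∈ I := hg ▸ Submodule.mem_span_singleton_self g
  obtain ⟨v, hv, hvg⟩ := hgI
  refine ⟨⟨v, hv⟩, ?_, g • u i, smul_mem_cone _ hgpos.le (mem_coneOf u i), ?_⟩
  · refine le_antisymm (sup_le (latticeSpan_facet_le u i) ?_) fun x hx => ?_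
    · rw [Submodule.span_singleton_le_iff_mem]; exact hv
    · have hfx : f x ∈ I := Submodule.mem_map_of_mem hx
      rw [hg, Submodule.mem_span_singleton] at hfx
      obtain ⟨a, ha⟩ := hfx
      refine Submodule.mem_sup.2 ⟨x - a • v, ?_, a • v,
        Submodule.smul_mem _ _ (Submodule.mem_span_singleton_self v), sub_add_cancel _ _⟩
      refine mem_latticeSpan_facet hd i (Submodule.sub_mem _ hx (Submodule.smul_mem _ _ hv)) ?_
      rw [← hf, map_sub, map_zsmul, hvg, ha, sub_self]
  · refine hd.mem_span_facet (Submodule.sub_mem _ ((mem_latticeSpan_coneOf hd).1 hv)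
      (Submodule.smul_mem _ _ (Submodule.subset_span (mem_coneOf u i)))) ?_
    rw [map_sub, ← hf, hvg, map_smul, hd i i]
    simp

theorem isNormal_normalVector [Module.Finite ℤ N] (hd : IsDualFamily u lam) (i : Fin (k + 1)) :
    IsNormal (facet u i) (coneOf u) (normalVector (facet u i) (coneOf u)) := by
  have h := exists_isNormal hd i
  rw [normalVector, dif_pos h]
  exact h.choose_spec

/-- The cone condition gives nonnegativity. If the value were zero, `lam i` would vanish on all of
N_σ, which is generated by the facet lattice and `v`. -/
theorem IsNormal.apply_pos (hd : IsDualFamily u lam) {i : Fin (k + 1)}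
    {v : latticeSpan (coneOf u)} (hv : IsNormal (facet u i) (coneOf u) v) :
    0 < lam i (toNQ (v : N)) := by
  obtain ⟨hsup, y, hy, hvy⟩ := hv
  have h0 := hd.apply_eq_zero_of_mem_span_facet hvy
  rw [map_sub, sub_eq_zero] at h0
  refine lt_of_le_of_ne (h0 ▸ (hd.mem_coneOf_iff.1 hy).2 i) fun hz => ?_
  obtain ⟨x, hx, hpos⟩ := exists_lattice_apply_ne_zero hd i
  rw [← hsup] at hx
  obtain ⟨a, ha, b, hb, rfl⟩ := Submodule.mem_sup.1 hx
  obtain ⟨c, rfl⟩ := Submodule.mem_span_singleton.1 hb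
  rw [map_add, map_add, apply_latticeSpan_facet hd i ha, map_zsmul, map_zsmul, ← hz] at hpos
  simp at hpos

theorem exists_basis_cons {P O : Submodule ℤ N} {v : N} (f : N →+ ℚ) (hP : ∀ x ∈ P, f x = 0)
    (hv : f v ≠ 0) (hO : P ⊔ Submodule.span ℤ {v} = O) {n : ℕ} (b : Module.Basis (Fin n) ℤ P) :
    ∃ B : Module.Basis (Fin (n + 1)) ℤ O, (B 0 : N) = v ∧ ∀ j : Fin n, (B j.succ : N) = b j := by
  have hvO : v ∈ O := by
    rw [← hO]
    exact Submodule.mem_sup_right (Submodule.mem_span_singleton_self v)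
  have hPO : P ≤ O := by
    rw [← hO]
    exact le_sup_left
  have hli : ∀ (c : ℤ), ∀ x ∈ P, c • v + x = 0 → c = 0 := by
    intro c x hx h
    have h1 : f (c • v + x) = 0 := by rw [h, map_zero]
    rw [map_add, hP x hx, add_zero, map_zsmul, zsmul_eq_mul] at h1
    exact Int.cast_eq_zero.1 ((mul_eq_zero.1 h1).resolve_right hv)
  have hsp : ∀ z ∈ O, ∃ c : ℤ, z + c • v ∈ P := by
    intro z hz
    rw [← hO] at hz
    obtain ⟨a, ha, b, hb, rfl⟩ := Submodule.mem_sup.1 hz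
    obtain ⟨c, rfl⟩ := Submodule.mem_span_singleton.1 hb
    refine ⟨-c, ?_⟩
    rwa [neg_smul, add_neg_cancel_right]
  have hB := Module.Basis.coe_mkFinConsOfLE v hvO b hPO hli hsp
  refine ⟨Module.Basis.mkFinConsOfLE v hvO b hPO hli hsp, ?_, fun j => ?_⟩
  · rw [hB, Fin.cons_zero]
  · rw [hB, Fin.cons_succ, Function.comp_apply, Submodule.coe_inclusion]

/-- A `ℤ`-basis of `N_τ` for a facet `τ` of `σ`, extended by a normal vector to one of `N_σ`. -/
theorem IsNormal.exists_basis (hd : IsDualFamily u lam) {i : Fin (k + 1)}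
    {v : latticeSpan (coneOf u)} (hv : IsNormal (facet u i) (coneOf u) v)
    (b : Module.Basis (Fin k) ℤ (latticeSpan (facet u i))) :
    ∃ B : Module.Basis (Fin (k + 1)) ℤ (latticeSpan (coneOf u)),
      (B 0 : N) = v ∧ ∀ j : Fin k, (B j.succ : N) = b j := by
  exact exists_basis_cons ((lam i).toAddMonoidHom.comp (toNQ (N := N)).toAddMonoidHom)
    (fun x hx => apply_latticeSpan_facet hd i hx) (hv.apply_pos hd).ne' hv.1 b

/-- The matrix of the linear forms `lam j` in a family of lattice vectors. -/
def latticeMatrix {k : ℕ} {σ : PointedCone ℚ (NQ N)} (lam : Fin k → MQ N)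
    (b : Fin k → latticeSpan σ) : Matrix (Fin k) (Fin k) ℚ :=
  Matrix.of fun r c => lam c (toNQ (b r : N))

/-- Two ℤ-bases differ by an integer matrix of determinant ±1. -/
theorem abs_det_latticeMatrix_eq {k : ℕ} {σ : PointedCone ℚ (NQ N)} (lam : Fin k → MQ N)
    (b b' : Module.Basis (Fin k) ℤ (latticeSpan σ)) :
    |(latticeMatrix lam b).det| = |(latticeMatrix lam b').det| := by
  have key : latticeMatrix lam b =
      ((b'.toMatrix b).transpose.map (Int.castRingHom ℚ)) * latticeMatrix lam b' := by
    ext r c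
    have h := congrArg (fun x : latticeSpan σ => lam c (toNQ (x : N))) (b'.sum_repr (b r))
    simp only [Submodule.coe_sum, map_sum, Submodule.coe_smul, map_zsmul] at h
    rw [Matrix.mul_apply]
    simp only [latticeMatrix, Matrix.of_apply]
    rw [← h]
    refine Finset.sum_congr rfl fun j _ => ?_
    simp [Module.Basis.toMatrix_apply, zsmul_eq_mul]
  rw [key, Matrix.det_mul, abs_mul]
  have h1 : IsUnit (b'.toMatrix b).det := by
    have := b'.isUnit_det b
    rwa [Module.Basis.det_apply] at this
  have h2 : (((b'.toMatrix b).transpose.map (Int.castRingHom ℚ)).det) =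
      (((b'.toMatrix b).det : ℤ) : ℚ) := by
    rw [← RingHom.mapMatrix_apply, ← RingHom.map_det, Matrix.det_transpose]; rfl
  rw [h2, ← Int.cast_abs, Int.isUnit_iff_abs_eq.1 h1, Int.cast_one, one_mul]

/-- In a basis made of `v` and a basis of the facet lattice, column `i` has the single nonzero entry
`lam i v`; expand along it. -/
theorem abs_det_latticeMatrix_facet (hd : IsDualFamily u lam) {i : Fin (k + 1)}
    {v : latticeSpan (coneOf u)} (hv : IsNormal (facet u i) (coneOf u) v)
    (b : Module.Basis (Fin k) ℤ (latticeSpan (facet u i)))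
    (b' : Module.Basis (Fin (k + 1)) ℤ (latticeSpan (coneOf u))) :
    |(latticeMatrix lam b').det| =
      lam i (toNQ (v : N)) * |(latticeMatrix (lam ∘ i.succAbove) b).det| := by
  obtain ⟨B, hB0, hBs⟩ := hv.exists_basis hd b
  rw [abs_det_latticeMatrix_eq lam b' B, Matrix.det_succ_column _ i, Fin.sum_univ_succ,
    Finset.sum_eq_zero, add_zero]
  · have h1 : (latticeMatrix lam B).submatrix (Fin.succAbove 0) i.succAbove =
        latticeMatrix (lam ∘ i.succAbove) b := by
      ext r c
      simp [latticeMatrix, hBs]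
    rw [h1, abs_mul, abs_mul, abs_pow, abs_neg, abs_one, one_pow, one_mul]
    congr 1
    simp only [latticeMatrix, Matrix.of_apply, hB0]
    exact abs_of_pos (hv.apply_pos hd)
  · intro j _
    simp [latticeMatrix, hBs, apply_latticeSpan_facet hd i (b j).2]

theorem exists_basis_latticeSpan [Module.Free ℤ N] [Module.Finite ℤ N] {k : ℕ} {u : Fin k → NQ N}
    {lam : Fin k → MQ N} (hd : IsDualFamily u lam) :
    Nonempty (Module.Basis (Fin k) ℤ (latticeSpan (coneOf u))) := by
  induction k with
  | zero =>
    have hN : latticeSpan (coneOf u) = ⊥ := by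
      refine (Submodule.eq_bot_iff _).2 fun x hx => ?_
      have h := hd.sum_eq ((mem_latticeSpan_coneOf hd).1 hx)
      rw [Finset.univ_eq_empty, Finset.sum_empty] at h
      exact Module.Flat.tensorProduct_mk_injective ℤ N ℚ (h.symm.trans (map_zero toNQ).symm)
    have : Subsingleton (latticeSpan (coneOf u)) := by rw [hN]; infer_instance
    exact ⟨Module.Basis.empty _⟩
  | succ k ih =>
    obtain ⟨b⟩ := ih (hd.comp_succAbove 0)
    obtain ⟨B, -⟩ := (isNormal_normalVector hd 0).exists_basis hd b
    exact ⟨B⟩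

end Lattice

section

/-! ### Lagrange interpolation on a line. -/

section Interpolation

open Polynomial in
/-- The leading coefficient in Lagrange interpolation, for a product of `k` linear forms restricted
to the line `x ↦ v + x • w` and with the zeros of `k + 1` further linear forms as nodes. -/
theorem sum_prod_div_eq {V : Type*} [AddCommGroup V] [Module ℚ V] {k : ℕ}
    (lam : Fin (k + 1) → Module.Dual ℚ V) (g : List (Module.Dual ℚ V)) (hg : g.length = k)
    (v w : V) (hw : ∀ i, lam i w ≠ 0) (z : Fin (k + 1) → V)
    (hz : ∀ i, z i = v - (lam i v / lam i w) • w)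
    (hne : ∀ i j, lam (i.succAbove j) (z i) ≠ 0) :
    ∑ i, (g.map fun f => f (z i)).prod / (lam i w * ∏ j : Fin k, lam (i.succAbove j) (z i)) =
      (g.map fun f => f w).prod / ∏ i, lam i w := by
  classical
  -- `x i` is the parameter at which the line v + ℚw meets the zero set of `lam i`, so `lam j (z i)`
  -- is `lam j w` times the difference of nodes `x i - x j`.
  let x : Fin (k + 1) → ℚ := fun i => -(lam i v / lam i w)
  have hzx (f : Module.Dual ℚ V) (i) : f (z i) = f v + f w * x i := by
    rw [hz, map_sub, map_smul, smul_eq_mul]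
    ring
  have hlz (i j) : lam j (z i) = lam j w * (x i - x j) := by
    rw [hzx]
    have := hw j
    simp only [x]
    field_simp
    ring
  let P : ℚ[X] := (g.map fun f => C (f v) + C (f w) * X).prod
  have hlin (f : Module.Dual ℚ V) : (C (f v) + C (f w) * X : ℚ[X]).natDegree ≤ 1 := by
    rw [add_comm]
    exact natDegree_linear_le
  have hPdeg : P.natDegree ≤ k := by
    refine (natDegree_list_prod_le _).trans ?_
    rw [← hg, List.map_map]
    refine (List.sum_le_card_nsmul _ 1 ?_).trans (by simp)
    intro n hn
    obtain ⟨f, -, rfl⟩ := List.mem_map.1 hn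
    exact hlin f
  have hPcoeff : P.coeff k = (g.map fun f => f w).prod := by
    have h := coeff_list_prod_of_natDegree_le (g.map fun f => C (f v) + C (f w) * X) 1 (by
      intro p hp
      obtain ⟨f, -, rfl⟩ := List.mem_map.1 hp
      exact hlin f)
    rw [List.length_map, mul_one, hg, List.map_map] at h
    rw [h]
    congr 1
    refine List.map_congr_left fun f _ => ?_
    simp
  have hPeval (i) : P.eval (x i) = (g.map fun f => f (z i)).prod := by
    simp only [P, eval_list_prod, List.map_map]
    congr 1
    refine List.map_congr_left fun f _ => ?_
    simp [hzx]
  have hinj : Set.InjOn x (Finset.univ : Finset (Fin (k + 1))) := by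
    intro i _ j _ h
    by_contra hij
    obtain ⟨l, rfl⟩ := Fin.exists_succAbove_eq (Ne.symm hij)
    exact hne i l (by rw [hlz, h, sub_self, mul_zero])
  have hL := Lagrange.coeff_eq_sum hinj (P := P) (by
    rw [Finset.card_univ, Fintype.card_fin]
    exact (degree_le_natDegree).trans_lt (by exact_mod_cast Nat.lt_succ_of_le hPdeg))
  rw [Finset.card_univ, Fintype.card_fin, Nat.add_sub_cancel, hPcoeff] at hL
  rw [hL, Finset.sum_div]
  refine Finset.sum_congr rfl fun i _ => ?_
  have herase : Finset.univ.erase i = Finset.univ.image i.succAbove := by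
    rw [Fin.image_succAbove_univ]
    ext j
    simp
  rw [herase, Finset.prod_image (fun a _ b _ h => Fin.succAbove_right_injective h),
    Fin.prod_univ_succAbove _ i, hPeval, div_div]
  simp only [hlz, Finset.prod_mul_distrib]
  congr 1
  ring

end Interpolation

/-! ### The action of a divisor, read off coefficient by coefficient. -/

variable {N : Type*} [AddCommGroup N]

theorem pairing_mk (σ : PointedCone ℚ (NQ N)) (m : MQ N) (w : linSpan σ) :
    pairing σ (Submodule.Quotient.mk m) w = m w := rfl

namespace Fan

variable {F : Fan N}

/-- A linear form on `N_ℚ` representing the local equation of a divisor on a cone. -/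
def QCartier.form (D : F.QCartier) (σ : F.Cone) : MQ N := Quotient.out (D.eqn σ)

theorem QCartier.mk_form (D : F.QCartier) (σ : F.Cone) :
    (Submodule.Quotient.mk (D.form σ) : MLoc σ.1) = D.eqn σ := Quotient.out_eq' _

theorem QCartier.pairing_eqn (D : F.QCartier) (σ : F.Cone) (w : linSpan σ.1) :
    pairing σ.1 (D.eqn σ) w = D.form σ w := by
  rw [← D.mk_form, pairing_mk]

theorem QCartier.form_eq (D : F.QCartier) {σ τ : F.Cone} (h : σ.1.IsFaceOf τ.1) {x : NQ N}
    (hx : x ∈ linSpan σ.1) : D.form σ x = D.form τ x := by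
  have h1 := D.compat σ τ h
  rw [← D.mk_form σ, ← D.mk_form τ] at h1
  have h2 : pairing σ.1 (Submodule.Quotient.mk (D.form τ)) ⟨x, hx⟩ =
      pairing σ.1 (Submodule.Quotient.mk (D.form σ)) ⟨x, hx⟩ :=
    congrArg (fun m => pairing σ.1 m ⟨x, hx⟩) h1
  exact h2.symm

/-- The form and its projection differ by an element of the complement, which kills `w`. The
projection vanishes on the span of σ, so on `w` it takes `a` times its value on the normal vector.
-/
theorem mul_actCoeff (Ψ : F.Complements) (D : F.QCartier) {σ τ : F.Cone} (h : σ.1 ≤ τ.1)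
    {w : NQ N} (hw : ∀ l ∈ Ψ.space σ, l w = 0) {a : ℚ}
    (ha : w - a • toNQ (normalVector σ.1 τ.1 : N) ∈ linSpan σ.1) :
    a * actCoeff Ψ D σ τ h = D.form τ w := by
  let p : MQ N := (perp σ.1).projection (Ψ.space σ) (Ψ.isCompl σ) (D.form τ)
  have h1 : actCoeff Ψ D σ τ h = p (toNQ (normalVector σ.1 τ.1 : N)) := by
    rw [actCoeff, ← D.mk_form τ]
    rfl
  have h2 : p ∈ perp σ.1 := Submodule.projection_apply_mem _ _
  have h3 : D.form τ - p ∈ Ψ.space σ := by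
    have := Submodule.projection_add_projection_eq_self (Ψ.isCompl σ) (D.form τ)
    rw [sub_eq_iff_eq_add'.2 this.symm]
    exact Submodule.projection_apply_mem _ _
  have h4 := hw _ h3
  have h5 := (Submodule.mem_dualAnnihilator p).1 h2 _ ha
  rw [LinearMap.sub_apply, sub_eq_zero] at h4
  rw [map_sub, map_smul, smul_eq_mul, sub_eq_zero] at h5
  rw [h1, h4, h5]

open Classical in
theorem act_apply (Ψ : F.Complements) (D : F.QCartier) (c : F.Cycles) (σ : F.Cone) :
    act Ψ D c σ = ∑ τ : F.Cone, c τ *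
      if h : IsFacet τ.1 σ.1 then actCoeff Ψ D τ σ h.1.le else 0 := by
  rw [act, Finsupp.linearCombination_apply, Finsupp.sum_fintype _ _ (by simp),
    Finsupp.finsetSum_apply]
  refine Finset.sum_congr rfl fun τ _ => ?_
  rw [Finsupp.smul_apply, smul_eq_mul, Finsupp.finsetSum_apply]
  congr 1
  rw [Finset.sum_eq_single σ]
  · split_ifs <;> simp [orbitCycle]
  · intro ρ _ hρ
    split_ifs
    · simp [orbitCycle, hρ]
    · rfl
  · simp

theorem act_apply_coneOf_zero (Ψ : F.Complements) (D : F.QCartier) (c : F.Cycles)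
    {u : Fin 0 → NQ N} {lam : Fin 0 → MQ N} (hd : IsDualFamily u lam)
    (hmem : coneOf u ∈ F.cones) : act Ψ D c ⟨coneOf u, hmem⟩ = 0 := by
  rw [act_apply]
  refine Finset.sum_eq_zero fun τ _ => ?_
  rw [dif_neg, mul_zero]
  rintro ⟨-, h⟩
  rw [hd.dim_coneOf] at h
  omega

theorem act_apply_coneOf (Ψ : F.Complements) (D : F.QCartier) (c : F.Cycles) {k : ℕ}
    {u : Fin (k + 1) → NQ N} {lam : Fin (k + 1) → MQ N} (hd : IsDualFamily u lam)
    (hmem : coneOf u ∈ F.cones) (hface : ∀ i, facet u i ∈ F.cones) :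
    act Ψ D c ⟨coneOf u, hmem⟩ = ∑ i, c ⟨facet u i, hface i⟩ *
      actCoeff Ψ D ⟨facet u i, hface i⟩ ⟨coneOf u, hmem⟩ (IsDualFamily.facet_le u i) := by
  classical
  rw [act_apply]
  symm
  refine Finset.sum_of_injOn (fun i => (⟨facet u i, hface i⟩ : F.Cone)) ?_ (by simp) ?_ ?_
  · intro i _ j _ h
    exact hd.facet_injective (congrArg Subtype.val h)
  · intro τ _ hτ
    rw [dif_neg, mul_zero]
    intro h
    obtain ⟨i, hi⟩ := (isFacet_coneOf_iff hd).1 h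
    exact hτ ⟨i, by simp, Subtype.ext hi.symm⟩
  · intro i _
    rw [dif_pos ((isFacet_coneOf_iff hd).2 ⟨i, rfl⟩)]

end Fan

end

/-! ### Generic flags and the induction on the dimension of the cone. -/

section

variable {N : Type*} [AddCommGroup N] [Module.Finite ℤ N]
  {F : Fan N} (L : CompleteFlag (MQ N))

/-- A vector of the span of a cone of dimension `k + 1` annihilated by `L_k` is not in the span of
any facet. -/
theorem CompleteFlag.IsGeneric.apply_ne_zero {L : CompleteFlag (MQ N)} (hL : L.IsGeneric F)
    {k : ℕ} {u : Fin (k + 1) → NQ N} {lam : Fin (k + 1) → MQ N} (hd : IsDualFamily u lam)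
    (hmem : coneOf u ∈ F.cones) {w : NQ N} (hw : w ∈ linSpan (coneOf u))
    (hwL : ∀ l ∈ L.space k, l w = 0) (hw0 : w ≠ 0) (i : Fin (k + 1)) : lam i w ≠ 0 := by
  intro h
  have hwf := hd.mem_span_facet hw h
  have hc := (L.complements hL).isCompl ⟨facet u i, F.face_mem _ hmem _ (hd.facet_isFaceOf i)⟩
  change IsCompl (perp (facet u i)) (L.space (dim (facet u i))) at hc
  rw [hd.dim_facet] at hc
  refine hw0 ((Module.forall_dual_apply_eq_zero_iff ℚ w).1 fun f => ?_)
  obtain ⟨a, ha, b, hb, rfl⟩ := Submodule.mem_sup.1 (hc.sup_eq_top ▸ Submodule.mem_top : f ∈ _)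
  rw [LinearMap.add_apply, hwL b hb, (Submodule.mem_dualAnnihilator a).1 ha w hwf, add_zero]

/-- The annihilator of `L_{k-1}` in a space of dimension `k + 1` is not contained in a line. -/
theorem CompleteFlag.exists_annihilated_of_two_le {k : ℕ} {W : Submodule ℚ (NQ N)}
    (hW : Module.finrank ℚ W = k + 1) (hk : k ≠ 0) (w : NQ N) :
    ∃ v ∈ W, (∀ l ∈ L.space (k - 1), l v = 0) ∧ ∀ c : ℚ, v ≠ c • w := by
  by_contra! hcon
  have hle : W ⊓ (L.space (k - 1)).dualCoannihilator ≤ Submodule.span ℚ {w} := by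
    rintro v ⟨hv1, hv2⟩
    obtain ⟨c, hc⟩ := hcon v hv1 fun l hl => (Submodule.mem_dualCoannihilator v).1 hv2 l hl
    exact Submodule.mem_span_singleton.2 ⟨c, hc.symm⟩
  -- Against this bound, the intersection has dimension at least (k + 1) + (n - (k - 1)) - n = 2.
  have h1 : _ ≤ 1 := (Submodule.finrank_mono hle).trans 
    ((finrank_span_le_card ({w} : Set (NQ N))).trans (by simp))
  have h2 := Submodule.finrank_sup_add_finrank_inf_eq W (L.space (k - 1)).dualCoannihilator
  have h4 := Submodule.finrank_le (W ⊔ (L.space (k - 1)).dualCoannihilator)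
  have h5 := Submodule.finrank_le W
  have h6 := L.finrank_space (k - 1) (by rw [Subspace.dual_finrank_eq]; omega)
  have h3 : k - 1 + Module.finrank ℚ (L.space (k - 1)).dualCoannihilator =
      Module.finrank ℚ (NQ N) :=
    (congrArg (· + _) h6).symm.trans
      (Subspace.finrank_add_finrank_dualCoannihilator_eq (L.space (k - 1)))
  omega

theorem CompleteFlag.exists_annihilated {k : ℕ} {W : Submodule ℚ (NQ N)}
    (hW : Module.finrank ℚ W = k + 1) (w : NQ N) :
    ∃ v ∈ W, (∀ l ∈ L.space (k - 1), l v = 0) ∧ (k ≠ 0 → ∀ c : ℚ, v ≠ c • w) := by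
  by_cases hk : k = 0
  · exact ⟨0, W.zero_mem, fun l _ => map_zero l, fun h => absurd hk h⟩
  · obtain ⟨v, hv, hvL, hvw⟩ := L.exists_annihilated_of_two_le hW hk w
    exact ⟨v, hv, hvL, fun _ => hvw⟩

/-- The coefficient of a simplicial cone of dimension `k` in a product of divisors. -/
theorem Fan.prod_act_apply [Module.Free ℤ N] {L : CompleteFlag (MQ N)} (hL : L.IsGeneric F) {k : ℕ}
    {u : Fin k → NQ N} {lam : Fin k → MQ N} (hd : IsDualFamily u lam)
    (hmem : coneOf u ∈ F.cones) (b : Module.Basis (Fin k) ℤ (latticeSpan (coneOf u)))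
    {w : NQ N} (hw : w ∈ linSpan (coneOf u)) (hwL : ∀ l ∈ L.space (k - 1), l w = 0)
    (hw0 : k ≠ 0 → w ≠ 0) (D : List F.QCartier) :
    (D.map (act (L.complements hL))).prod F.fundamentalCycle ⟨coneOf u, hmem⟩ =
      if D.length = k then
        (D.map fun E => E.form ⟨coneOf u, hmem⟩ w).prod * |(latticeMatrix lam b).det| /
          ∏ i, lam i w
      else 0 := by
  -- The vector must vary: each facet is treated with its own `z i`.
  induction k generalizing w D with
  | zero =>
    cases D with
    | nil =>
      have h : (⟨coneOf u, hmem⟩ : F.Cone) = F.zeroCone := by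
        refine Subtype.ext ?_
        change coneOf u = ⊥
        rw [coneOf, Set.range_eq_empty, PointedCone.hull, Submodule.span_empty]
      rw [h]
      simp [Fan.fundamentalCycle, Fan.orbitCycle]
    | cons E D =>
      rw [List.map_cons, List.prod_cons, Module.End.mul_apply, act_apply_coneOf_zero _ _ _ hd,
        if_neg (by simp)]
  | succ k ih =>
    have hwne := hw0 k.succ_ne_zero
    cases D with
    | nil =>
      rw [if_neg (by simp), List.map_nil, List.prod_nil, Module.End.one_apply,
        Fan.fundamentalCycle, Fan.orbitCycle, Finsupp.single_apply, if_neg]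
      intro h
      have h1 : (⊥ : PointedCone ℚ (NQ N)) = coneOf u := congrArg Subtype.val h
      have h2 := mem_coneOf u 0
      rw [← h1, Submodule.mem_bot] at h2
      have h3 := hd 0 0
      simp [h2] at h3
    | cons E D =>
      rw [Nat.add_sub_cancel] at hwL
      have hface (i) : facet u i ∈ F.cones := F.face_mem _ hmem _ (hd.facet_isFaceOf i)
      have hlw := hL.apply_ne_zero hd hmem hw hwL hwne
      obtain ⟨v, hv, hvL, hvw⟩ := L.exists_annihilated hd.dim_coneOf w
      let z : Fin (k + 1) → NQ N := fun i => v - (lam i v / lam i w) • w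
      have hz (i) : z i ∈ linSpan (facet u i) := by
        refine hd.mem_span_facet (Submodule.sub_mem _ hv (Submodule.smul_mem _ _ hw)) ?_
        simp only [z]
        rw [map_sub, map_smul, smul_eq_mul, div_mul_cancel₀ _ (hlw i), sub_self]
      have hzL (i) : ∀ l ∈ L.space (k - 1), l (z i) = 0 := by
        intro l hl
        simp only [z]
        rw [map_sub, map_smul, hvL l hl, hwL l (L.mono (Nat.sub_le k 1) hl), smul_zero, sub_zero]
      have hz0 (i) : k ≠ 0 → z i ≠ 0 := fun hk h => hvw hk _ (sub_eq_zero.1 h)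
      have hzne (i j) : lam (i.succAbove j) (z i) ≠ 0 := by
        cases k with
        | zero => exact j.elim0
        | succ k =>
          exact hL.apply_ne_zero (hd.comp_succAbove i) (hface i) (hz i) (hzL i)
            (hz0 i k.succ_ne_zero) j
      have b' (i) := (exists_basis_latticeSpan (hd.comp_succAbove i)).some
      -- The scalar is the one for which `w` minus that multiple of the normal vector is killed by
      -- `lam i`, hence lies in the span of the facet.
      have hact (i) : lam i w / lam i (toNQ (normalVector (facet u i) (coneOf u) : N)) *
          actCoeff (L.complements hL) E ⟨facet u i, hface i⟩ ⟨coneOf u, hmem⟩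
            (IsDualFamily.facet_le u i) = E.form ⟨coneOf u, hmem⟩ w := by
        refine mul_actCoeff _ _ _ ?_ ?_
        · change ∀ l ∈ L.space (dim (facet u i)), l w = 0
          rw [hd.dim_facet]
          exact hwL
        · have hn := (isNormal_normalVector hd i).apply_pos hd
          refine hd.mem_span_facet (Submodule.sub_mem _ hw (Submodule.smul_mem _ _
            (toNQ_mem_linSpan _ _))) ?_
          rw [map_sub, map_smul, smul_eq_mul, div_mul_cancel₀ _ hn.ne', sub_self]
      rw [List.map_cons, List.prod_cons, Module.End.mul_apply, act_apply_coneOf _ _ _ hd hmem hface]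
      have hih (i) := ih (hd.comp_succAbove i) (hface i) (b' i) (hz i) (hzL i) (hz0 i) D
      change ∀ i, (D.map (act (L.complements hL))).prod F.fundamentalCycle
        ⟨facet u i, hface i⟩ = _ at hih
      simp only [hih, List.length_cons, Nat.add_right_cancel_iff]
      split_ifs with hlen
      · have hlag := sum_prod_div_eq lam (D.map fun E => E.form ⟨coneOf u, hmem⟩)
          (by rw [List.length_map, hlen]) v w hlw z (fun _ => rfl) hzne
        simp only [List.map_map, Function.comp_def] at hlag
        rw [List.map_cons, List.prod_cons, mul_right_comm, mul_div_assoc, ← hlag, Finset.mul_sum]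
        refine Finset.sum_congr rfl fun i _ => ?_
        obtain ⟨δ, hδ⟩ : ∃ δ, δ =
            |(latticeMatrix (σ := coneOf (u ∘ i.succAbove)) (lam ∘ i.succAbove) (b' i)).det| :=
          ⟨_, rfl⟩
        have hdet : |(latticeMatrix lam b).det| =
            lam i (toNQ (normalVector (facet u i) (coneOf u) : N)) * δ :=
          hδ ▸ abs_det_latticeMatrix_facet hd (isNormal_normalVector hd i) (b' i) b
        have hn := (isNormal_normalVector hd i).apply_pos hd
        have hform : (D.map fun E => E.form ⟨coneOf (u ∘ i.succAbove), hface i⟩ (z i)) =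
            D.map fun E => E.form ⟨coneOf u, hmem⟩ (z i) :=
          List.map_congr_left fun E _ => E.form_eq (hd.facet_isFaceOf i) (hz i)
        have hprod : ∏ j, lam (i.succAbove j) (z i) ≠ 0 :=
          Finset.prod_ne_zero_iff.2 fun j _ => hzne i j
        have hlwi := hlw i
        rw [hform, ← hδ, hdet, ← hact i]
        simp only [Function.comp_apply]
        field_simp
      · simp

end

/-! ### Extreme rays of the dual cone and the volume condition. -/

section ExtremeRays

variable {N : Type*} [AddCommGroup N] {k : ℕ} {u : Fin k → NQ N} {lam : Fin k → MQ N}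

theorem exists_coneOf_of_isSimplicial {σ : PointedCone ℚ (NQ N)} (hσ : σ.IsSimplicial) :
    ∃ u : Fin (dim σ) → NQ N, LinearIndependent ℚ u ∧ σ = coneOf u := by
  obtain ⟨s, hs, hli, rfl⟩ := hσ
  have := hs.fintype
  let e := (Fintype.equivFin s).symm
  have hu : LinearIndependent ℚ (fun i => (e i : NQ N)) :=
    LinearIndependent.comp hli e e.injective
  have hr : PointedCone.hull ℚ s = coneOf fun i => (e i : NQ N) := by
    have : Set.range (fun i => (e i : NQ N)) = s := by
      change Set.range (Subtype.val ∘ e) = s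
      rw [e.surjective.range_comp, Subtype.range_coe]
    rw [coneOf, this]
  obtain ⟨lam, hd⟩ := exists_dualFamily hu
  have hdim : dim (PointedCone.hull ℚ s) = Fintype.card s := by rw [hr, hd.dim_coneOf]
  rw [hdim]
  exact ⟨_, hu, hr⟩

theorem mk_mem_dualImage {m : MQ N} (hm : ∀ i, 0 ≤ m (u i)) :
    (Submodule.Quotient.mk m : MLoc (coneOf u)) ∈ dualImage (coneOf u) := by
  refine Submodule.mem_map.2 ⟨m, fun x hx => ?_, rfl⟩
  obtain ⟨c, hc, rfl⟩ := exists_coeff_of_mem_coneOf hx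
  change 0 ≤ m (∑ i, c i • u i)
  rw [map_sum]
  exact Finset.sum_nonneg fun i _ => by
    rw [map_smul]
    exact mul_nonneg (hc i) (hm i)

theorem exists_mk_of_mem_dualImage {t : MLoc (coneOf u)} (ht : t ∈ dualImage (coneOf u)) :
    ∃ m : MQ N, Submodule.Quotient.mk m = t ∧ ∀ i, 0 ≤ m (u i) := by
  obtain ⟨m, hm, rfl⟩ := Submodule.mem_map.1 ht
  exact ⟨m, rfl, fun i => hm (mem_coneOf u i)⟩

/-- The extreme rays of the image of the dual cone are spanned by the dual family. -/
theorem OnExtremeRay.exists_pairing_eq [Nonempty (Fin k)] (hd : IsDualFamily u lam)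
    {t : MLoc (coneOf u)} (ht : OnExtremeRay (dualImage (coneOf u)) t) :
    ∃ (j : Fin k) (c : ℚ), 0 ≤ c ∧ ∀ x : linSpan (coneOf u),
      pairing (coneOf u) t x = c * lam j x := by
  obtain ⟨ρ, hρ, hdim, htρ⟩ := ht
  obtain ⟨m, rfl, hm⟩ := exists_mk_of_mem_dualImage (hρ.le htρ)
  have hlamC (j) : (Submodule.Quotient.mk (lam j) : MLoc (coneOf u)) ∈ dualImage (coneOf u) :=
    mk_mem_dualImage fun i => by rw [hd]; split_ifs <;> simp
  -- Subtracting `m (u j) • lam j` from `m` leaves a form that is still nonnegative on the cone, so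
  -- the face ρ contains the summand `lam j`.
  have hlam (j) (hj : 0 < m (u j)) : (Submodule.Quotient.mk (lam j) : MLoc (coneOf u)) ∈ ρ := by
    have h1 : (Submodule.Quotient.mk (m - m (u j) • lam j) : MLoc (coneOf u)) ∈
        dualImage (coneOf u) := mk_mem_dualImage fun i => by
      rw [LinearMap.sub_apply, LinearMap.smul_apply, hd j i]
      split_ifs with h
      · simp [h]
      · simpa using hm i
    refine hρ.mem_of_smul_add_mem (hlamC j) h1 hj ?_
    rwa [← Submodule.Quotient.mk_smul, ← Submodule.Quotient.mk_add, add_sub_cancel]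
  let y (i) : linSpan (coneOf u) := ⟨u i, Submodule.subset_span (mem_coneOf u i)⟩
  have hpair (j i) : pairing (coneOf u) (Submodule.Quotient.mk (lam j)) (y i) =
      if j = i then 1 else 0 := hd j i
  -- Two different dual forms are independent and cannot both lie in the one-dimensional ρ.
  have huniq (j l) (hj : 0 < m (u j)) (hl : 0 < m (u l)) : j = l := by
    by_contra hjl
    let a : Submodule.span ℚ (ρ : Set (MLoc (coneOf u))) :=
      ⟨_, Submodule.subset_span (hlam j hj)⟩
    have ha : a ≠ 0 := by
      intro h
      have h1 := hpair j j
      rw [show (Submodule.Quotient.mk (lam j) : MLoc (coneOf u)) = 0 from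
        congrArg Subtype.val h, map_zero, if_pos rfl] at h1
      exact zero_ne_one h1
    obtain ⟨c, hc⟩ := (finrank_eq_one_iff_of_nonzero' a ha).1 hdim
      ⟨_, Submodule.subset_span (hlam l hl)⟩
    have h1 : c • (Submodule.Quotient.mk (lam j) : MLoc (coneOf u)) =
      Submodule.Quotient.mk (lam l) := congrArg Subtype.val hc
    have h2 := congrArg (fun f => pairing (coneOf u) f (y l)) h1
    simp [hpair, hjl] at h2
  obtain ⟨j, hj⟩ : ∃ j, ∀ l, l ≠ j → m (u l) = 0 := by
    by_cases h : ∃ j, 0 < m (u j)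
    · obtain ⟨j, hj⟩ := h
      exact ⟨j, fun l hl => le_antisymm (not_lt.1 fun h => hl (huniq l j h hj)) (hm l)⟩
    · exact ⟨Classical.arbitrary _, fun l _ => le_antisymm (not_lt.1 fun hl => h ⟨l, hl⟩) (hm l)⟩
  refine ⟨j, m (u j), hm j, fun x => ?_⟩
  rw [pairing_mk]
  conv_lhs => rw [← hd.sum_eq x.2]
  rw [map_sum, Finset.sum_eq_single j]
  · rw [map_smul, smul_eq_mul, mul_comm]
  · intro l _ hl
    rw [map_smul, hj l hl, smul_zero]
  · simp

/-- If the simplex spanned by vectors on the extreme rays has lattice volume `1 / k!`, the product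
of the vectors is a multiple of the product of the dual family. -/
theorem prod_pairing_eq (hd : IsDualFamily u lam)
    (b : Module.Basis (Fin k) ℤ (latticeSpan (coneOf u))) {t : Fin k → MLoc (coneOf u)}
    (ht : ∀ i, OnExtremeRay (dualImage (coneOf u)) (t i))
    (hdet : |Matrix.det (Matrix.of fun i j : Fin k =>
      pairing (coneOf u) (t j) (latticeIncl (coneOf u) (b i)))| = 1) (w : linSpan (coneOf u)) :
    |(latticeMatrix lam b).det| * ∏ i, pairing (coneOf u) (t i) w = ∏ i, lam i w := by
  have h (i : Fin k) : ∃ (j : Fin k) (c : ℚ), 0 ≤ c ∧ ∀ x : linSpan (coneOf u),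
      pairing (coneOf u) (t i) x = c * lam j x := by
    have : Nonempty (Fin k) := ⟨i⟩
    exact (ht i).exists_pairing_eq hd
  choose p c hc hp using h
  have hM : (Matrix.of fun i j : Fin k =>
      pairing (coneOf u) (t j) (latticeIncl (coneOf u) (b i))) =
      Matrix.of fun i j => c j * (latticeMatrix lam b).submatrix id p i j := by
    ext i j
    simp only [Matrix.of_apply, hp]
    rfl
  rw [hM, Matrix.det_mul_row] at hdet
  -- Two forms on the same ray would give equal columns and a zero determinant, so `p` is a
  -- permutation.
  have hinj : Function.Injective p := by
    intro i j hij
    by_contra hne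
    rw [Matrix.det_zero_of_column_eq hne (by simp [hij]), mul_zero, abs_zero] at hdet
    exact zero_ne_one hdet
  let e := Equiv.ofBijective p (Finite.injective_iff_bijective.1 hinj)
  have hperm := Matrix.det_permute' e (latticeMatrix lam b)
  change ((latticeMatrix lam b).submatrix id p).det = _ at hperm
  rw [hperm, abs_mul, abs_mul, abs_of_nonneg (Finset.prod_nonneg fun i _ => hc i)] at hdet
  have hsign : |((Equiv.Perm.sign e : ℤ) : ℚ)| = 1 := by
    rw [← Int.cast_abs, Int.isUnit_iff_abs_eq.1 (Equiv.Perm.sign e).isUnit, Int.cast_one]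
  rw [hsign, one_mul] at hdet
  simp only [hp, Finset.prod_mul_distrib]
  rw [← mul_assoc, mul_comm |_|, hdet, one_mul]
  exact e.prod_comp fun i => lam i w

end ExtremeRays

/-! ### From words in the divisors to polynomial expressions. -/

section Words

theorem homogeneousComponent_prod_X {s : ℕ} (k : ℕ) (l : List (Fin s)) :
    MvPolynomial.homogeneousComponent k (l.map (MvPolynomial.X (R := ℚ))).prod =
      if k = l.length then (l.map (MvPolynomial.X (R := ℚ))).prod else 0 := by
  refine MvPolynomial.homogeneousComponent_of_mem ?_
  rw [MvPolynomial.mem_homogeneousSubmodule]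
  induction l with
  | nil => exact MvPolynomial.isHomogeneous_one _ _
  | cons i l ih =>
    rw [List.map_cons, List.prod_cons, List.length_cons, add_comm]
    exact (MvPolynomial.isHomogeneous_X ℚ i).mul ih

theorem freeAlgebra_linearMap_ext {s : ℕ} {A : Type*} [AddCommGroup A] [Module ℚ A]
    {f g : FreeAlgebra ℚ (Fin s) →ₗ[ℚ] A}
    (h : ∀ l : List (Fin s), f (l.map (FreeAlgebra.ι ℚ)).prod = g (l.map (FreeAlgebra.ι ℚ)).prod) :
    f = g := by
  refine (FreeAlgebra.basisFreeMonoid ℚ (Fin s)).ext fun l => ?_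
  have hl : FreeAlgebra.basisFreeMonoid ℚ (Fin s) l =
      (l.toList.map (FreeAlgebra.ι ℚ)).prod := by
    change MonoidAlgebra.lift ℚ _ _ (FreeMonoid.lift (FreeAlgebra.ι ℚ))
      (MonoidAlgebra.single l 1) = _
    rw [MonoidAlgebra.lift_single, one_smul, FreeMonoid.lift_apply]
  rw [hl]
  exact h _

variable {N : Type*} [AddCommGroup N] [Module.Free ℤ N] [Module.Finite ℤ N] {F : Fan N}

/-- Both sides are linear in `p`, so words suffice. Taking the degree-`k` component matches the
vanishing for words of length other than `k`. -/
theorem Fan.actExpr_apply {L : CompleteFlag (MQ N)} (hL : L.IsGeneric F) {k : ℕ}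
    {u : Fin k → NQ N} {lam : Fin k → MQ N} (hd : IsDualFamily u lam)
    (hmem : coneOf u ∈ F.cones) (b : Module.Basis (Fin k) ℤ (latticeSpan (coneOf u)))
    {w : NQ N} (hw : w ∈ linSpan (coneOf u)) (hwL : ∀ l ∈ L.space (k - 1), l w = 0)
    (hw0 : k ≠ 0 → w ≠ 0) {s : ℕ} (E : Fin s → F.QCartier) (p : FreeAlgebra ℚ (Fin s)) :
    actExpr (L.complements hL) E p F.fundamentalCycle ⟨coneOf u, hmem⟩ =
      MvPolynomial.eval (fun i => (E i).form ⟨coneOf u, hmem⟩ w)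
        (MvPolynomial.homogeneousComponent k (commPoly p)) *
        (|(latticeMatrix lam b).det| / ∏ i, lam i w) := by
  let C : ℚ := |(latticeMatrix lam b).det| / ∏ i, lam i w
  let f : FreeAlgebra ℚ (Fin s) →ₗ[ℚ] ℚ :=
    Finsupp.lapply ⟨coneOf u, hmem⟩ ∘ₗ LinearMap.applyₗ F.fundamentalCycle ∘ₗ
      (actExpr (L.complements hL) E).toLinearMap
  let g : FreeAlgebra ℚ (Fin s) →ₗ[ℚ] ℚ :=
    LinearMap.mulRight ℚ C ∘ₗ
      (MvPolynomial.aeval (fun i => (E i).form ⟨coneOf u, hmem⟩ w)).toLinearMap ∘ₗ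
      MvPolynomial.homogeneousComponent k ∘ₗ commPoly.toLinearMap
  have key : f = g := by
    refine freeAlgebra_linearMap_ext fun l => ?_
    change actExpr (L.complements hL) E _ F.fundamentalCycle ⟨coneOf u, hmem⟩ =
      MvPolynomial.aeval (fun i => (E i).form ⟨coneOf u, hmem⟩ w)
        (MvPolynomial.homogeneousComponent k (commPoly _)) * C
    rw [map_list_prod, map_list_prod, List.map_map, List.map_map]
    have h1 : (actExpr (L.complements hL) E ∘ FreeAlgebra.ι ℚ) =
        act (L.complements hL) ∘ E := by
      ext1 i
      simp [actExpr]
    have h2 : ((commPoly : FreeAlgebra ℚ (Fin s) →ₐ[ℚ] _) ∘ FreeAlgebra.ι ℚ) =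
        MvPolynomial.X := by
      ext1 i
      simp [commPoly]
    rw [h1, h2, ← List.map_map, homogeneousComponent_prod_X,
      prod_act_apply hL hd hmem b hw hwL hw0, List.length_map, List.map_map]
    by_cases hk : k = l.length
    · rw [if_pos hk, if_pos hk.symm, map_list_prod, List.map_map, mul_div_assoc]
      congr 3
      ext1 i
      simp
    · rw [if_neg hk, if_neg (Ne.symm hk), map_zero, zero_mul]
  exact LinearMap.congr_fun key p

end Words

end Toric

end

theorem corollary2 {N : Type*} [AddCommGroup N] [Module.Free ℤ N] [Module.Finite ℤ N]
    (F : Toric.Fan N) (L : Toric.CompleteFlag (Toric.MQ N)) (hL : L.IsGeneric F)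
    (k : ℕ) (σ : F.Cone) (hdim : Toric.dim σ.1 = k) (hσ : σ.1.IsSimplicial)
    (s : ℕ) (E : Fin s → F.QCartier)
    (q : MvPolynomial (Fin s) ℚ) (hq : q.IsHomogeneous k)
    (w : Toric.linSpan σ.1) (hw : w ≠ 0)
    (hwL : ∀ l ∈ L.space (k - 1), l (w : Toric.NQ N) = 0)
    (t : Fin k → Toric.MLoc σ.1)
    (ht : ∀ i, Toric.OnExtremeRay (Toric.dualImage σ.1) (t i))
    (hvol : Toric.simplexVolume σ.1 (Fin.cons 0 t : Fin (k + 1) → Toric.MLoc σ.1) =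
      1 / (k.factorial : ℚ)) :
    (∀ i, Toric.pairing σ.1 (t i) w ≠ 0) ∧
    ∀ p : FreeAlgebra ℚ (Fin s), Toric.commPoly p = q →
      (Toric.Fan.actExpr (L.complements hL) E p F.fundamentalCycle) σ =
        MvPolynomial.eval (fun i => Toric.pairing σ.1 ((E i).eqn σ) w) q /
          ∏ i, Toric.pairing σ.1 (t i) w := by
  obtain ⟨σ, hmem⟩ := σ
  obtain ⟨u, hu, rfl⟩ : ∃ u : Fin k → Toric.NQ N, LinearIndependent ℚ u ∧ σ = Toric.coneOf u := by
    subst hdim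
    exact Toric.exists_coneOf_of_isSimplicial hσ
  obtain ⟨lam, hd⟩ := Toric.exists_dualFamily hu
  have hw0 : (w : Toric.NQ N) ≠ 0 := fun h => hw (Subtype.ext h)
  have hb := Toric.exists_basis_latticeSpan hd
  have hfac : (k.factorial : ℚ) ≠ 0 := Nat.cast_ne_zero.2 k.factorial_ne_zero
  -- This selects the same basis `hb.some` that is used below in `prod_pairing_eq`.
  simp only [Toric.simplexVolume, dif_pos hb, Fin.cons_succ, Fin.cons_zero, sub_zero] at hvol
  have hdet := mul_left_cancel₀ (one_div_ne_zero hfac) (hvol.trans (mul_one _).symm)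
  have hprod := Toric.prod_pairing_eq hd hb.some ht hdet w
  have hlam : ∏ i, lam i w ≠ 0 := by
    refine Finset.prod_ne_zero_iff.2 fun i _ => ?_
    cases k with
    | zero => exact i.elim0
    | succ k => exact hL.apply_ne_zero hd hmem w.2 hwL hw0 i
  refine ⟨fun i hi => ?_, ?_⟩
  · rw [Finset.prod_eq_zero (Finset.mem_univ i) hi, mul_zero] at hprod
    exact hlam hprod.symm
  · rintro p rfl
    rw [Toric.Fan.actExpr_apply hL hd hmem hb.some w.2 hwL fun _ => hw0,
      MvPolynomial.homogeneousComponent_of_mem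
        ((MvPolynomial.mem_homogeneousSubmodule k _).2 hq), if_pos rfl]
    rw [← hprod] at hlam ⊢
    rw [div_mul_cancel_left₀ (left_ne_zero_of_mul hlam), div_eq_mul_inv]
    congr 3
    ext1 i
    exact ((E i).pairing_eqn ⟨Toric.coneOf u, hmem⟩ w).symm
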